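/- **Lemma 2.1 (Quadratic form).** Let $V:\mathbb R^3\to\mathbb R$ be in the Kato class, i.e. $V$ is measurable and $$\lim_{r\to0+}\ \sup_{x\in\mathbb R^3}\int_{|x-y|\le r}\frac{|V(y)|}{|x-y|}\,dy=0 .$$ Let $\mathcal H=-\Delta+V$, and let $q$ be its quadratic form $$q(u,v)=\int_{\mathbb R^3}u\,\overline{\mathcal Hv}\,dx ,$$ understood for $u,v\in H^1(\mathbb R^3)$ (complex-valued) as $$q(u,v)=\int_{\mathbb R^3}\nabla u\cdot\overline{\nabla v}\,dx+\int_{\mathbb R^3}V\,u\,\overline v\,dx .$$ Then: 1. The integrals defining $q(u,v)$ converge absolutely for all $u,v\in H^1$. If $u\in H^1$ and $v$ is a Schwartz function, then $u\,\overline{(-\Delta v+Vv)}$ is integrable and $q(u,v)=\int_{\mathbb R^3}u\,\overline{(-\Delta v+Vv)}\,dx$. 2. There exists $a_0>1$ such that for every $a\ge a_0$ and every $u\in H^1$ the number $q(u,u)$ is real and $$\tfrac12\|\nabla u\|_{L^2}^2-a\|u\|_{L^2}^2\ \le\ q(u,u)\ \le\ \tfrac32\|\nabla u\|_{L^2}^2+a\|u\|_{L^2}^2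 .$$ 3. Consequently $q$ is a lower semibounded closed form with form domain $H^1$. That is, $H^1$ is dense in $L^2$; $q$ is a Hermitian sesquilinear form on $H^1$; there is $M\in\mathbb R$ with $q(u,u)\ge -M\|u\|_{L^2}^2$ for all $u\in H^1$; and if $u_n\in H^1$, $u_n\to u$ in $L^2$ and $q(u_n-u_m,u_n-u_m)\to0$ as $n,m\to\infty$, then $u\in H^1$ and $q(u_n-u,u_n-u)\to0$. -/

import Mathlib

open MeasureTheory Filter Topology
open scoped ENNReal SchwartzMap LineDeriv Laplacian ComplexConjugate

noncomputable section

namespace KatoForm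

/-- Euclidean space `ℝ³`. -/
abbrev R3 : Type := EuclideanSpace ℝ (Fin 3)

/-- The complex Hilbert space `L²(ℝ³)`. -/
abbrev L2 : Type := Lp ℂ 2 (volume : Measure R3)

/-- The Kato class: real-valued (Lebesgue measurable) functions `V` on `ℝ³` with
`lim_{r → 0+} sup_x ∫_{|x-y| ≤ r} |V(y)| / |x-y| dy = 0`. The integral is the Lebesgue integral of
a nonnegative function with values in `[0, ∞]`. -/
def IsKatoClass (V : R3 → ℝ) : Prop :=
  AEMeasurable V volume ∧
    Tendsto (fun r : ℝ => ⨆ x : R3, ∫⁻ y in Metric.closedBall x r, ‖V y‖ₑ / ‖x - y‖ₑ)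
      (𝓝[>] 0) (𝓝 0)

/-- The Sobolev space `H¹(ℝ³)`, as a subspace of `L²(ℝ³)`. -/
def H1 : Submodule ℂ L2 where
  carrier := {u | TemperedDistribution.MemSobolev 1 2 (u : 𝓢'(R3, ℂ))}
  zero_mem' := by
    have h : ((0 : L2) : 𝓢'(R3, ℂ)) = 0 := by
      rw [← Lp.toTemperedDistributionCLM_apply, map_zero]
    simp only [Set.mem_ofPred_eq, h, TemperedDistribution.memSobolev_fun_zero]
  add_mem' := by
    intro u v hu hv
    have h : ((u + v : L2) : 𝓢'(R3, ℂ)) = (u : 𝓢'(R3, ℂ)) + (v : 𝓢'(R3, ℂ)) := by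
      simp only [← Lp.toTemperedDistributionCLM_apply, map_add]
    simp only [Set.mem_ofPred_eq, h] at hu hv ⊢
    exact hu.add hv
  smul_mem' := by
    intro c u hu
    have h : ((c • u : L2) : 𝓢'(R3, ℂ)) = c • (u : 𝓢'(R3, ℂ)) := by
      simp only [← Lp.toTemperedDistributionCLM_apply, map_smul]
    simp only [Set.mem_ofPred_eq, h] at hu ⊢
    exact hu.smul c

/-- The distributional partial derivatives of an `H¹` function are `L²` functions. -/
theorem exists_partial (i : Fin 3) (u : H1) :
    ∃ g : L2, ∂_{(EuclideanSpace.single i (1 : ℝ) : R3)} ((u : L2) : 𝓢'(R3, ℂ))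
      = (g : 𝓢'(R3, ℂ)) := by
  have h := TemperedDistribution.MemSobolev.lineDerivOp
    (m := (EuclideanSpace.single i (1 : ℝ) : R3)) u.2
  rw [sub_self] at h
  exact TemperedDistribution.memSobolev_zero_iff.mp h

/-- The `i`-th distributional partial derivative `∂ᵢu ∈ L²(ℝ³)` of `u ∈ H¹(ℝ³)`. -/
def partialDeriv (i : Fin 3) (u : H1) : L2 := (exists_partial i u).choose

theorem partialDeriv_spec (i : Fin 3) (u : H1) :
    ∂_{(EuclideanSpace.single i (1 : ℝ) : R3)} ((u : L2) : 𝓢'(R3, ℂ))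
      = (partialDeriv i u : 𝓢'(R3, ℂ)) := (exists_partial i u).choose_spec

/-- `‖∇u‖²`, the square of the `L²` norm of the gradient. -/
def gradNormSq (u : H1) : ℝ := ∑ i : Fin 3, ‖partialDeriv i u‖ ^ 2

/-- The form `q(u, v) = ∫ ∇u · conj(∇v) + ∫ V u conj(v)` of `-Δ + V` on `H¹(ℝ³)`. -/
def q (V : R3 → ℝ) (u v : H1) : ℂ :=
  (∑ i : Fin 3, ∫ x, partialDeriv i u x * conj (partialDeriv i v x))
    + ∫ x, (V x : ℂ) * ((u : L2) x * conj ((v : L2) x))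

theorem mem_H1_iff (u : L2) : u ∈ H1 ↔ TemperedDistribution.MemSobolev 1 2 (u : 𝓢'(R3, ℂ)) :=
  Iff.rfl

theorem toLp_mem_H1 (f : 𝓢(R3, ℂ)) : (f.toLp 2 volume : L2) ∈ H1 := by
  rw [mem_H1_iff, Lp.toTemperedDistribution_toLp_eq]
  exact f.memSobolev

/-- A Schwartz function as an element of `H¹(ℝ³)`. -/
def schwartzToH1 (f : 𝓢(R3, ℂ)) : H1 := ⟨f.toLp 2 volume, toLp_mem_H1 f⟩

/-- The Schrödinger operator `(-Δ + V) f`, as a function, for a Schwartz function `f`. -/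
def schrodinger (V : R3 → ℝ) (f : 𝓢(R3, ℂ)) (x : R3) : ℂ := -(Δ f) x + (V x : ℂ) * f x

/-- `Q` is a lower semibounded Hermitian sesquilinear form (linear in the first variable) with the
dense subspace `D` of the Hilbert space `H` as its domain. -/
structure IsLowerSemiboundedForm {H : Type*} [NormedAddCommGroup H] [InnerProductSpace ℂ H]
    (D : Submodule ℂ H) (Q : D → D → ℂ) : Prop where
  dense : Dense (D : Set H)
  add_left : ∀ u v w : D, Q (u + v) w = Q u w + Q v w
  smul_left : ∀ (c : ℂ) (u v : D), Q (c • u) v = c * Q u v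
  conj_symm : ∀ u v : D, conj (Q u v) = Q v u
  lower_bound : ∃ M : ℝ, ∀ u : D, -M * ‖(u : H)‖ ^ 2 ≤ (Q u u).re

/-- The form `Q` with domain `D` is closed: if `uₙ ∈ D` converges to `u` in `H` and
`Q(uₙ - uₘ, uₙ - uₘ) → 0` as `n, m → ∞`, then `u ∈ D` and `Q(uₙ - u, uₙ - u) → 0`. -/
def IsClosedForm {H : Type*} [NormedAddCommGroup H] [InnerProductSpace ℂ H]
    (D : Submodule ℂ H) (Q : D → D → ℂ) : Prop :=
  ∀ (s : ℕ → D) (u : H), Tendsto (fun n => (s n : H)) atTop (𝓝 u) →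
    Tendsto (fun p : ℕ × ℕ => Q (s p.1 - s p.2) (s p.1 - s p.2)) atTop (𝓝 0) →
    ∃ hu : u ∈ D, Tendsto (fun n => Q (s n - ⟨u, hu⟩) (s n - ⟨u, hu⟩)) atTop (𝓝 0)

end KatoForm

end

/-! Everything rests on one estimate: for every ε > 0 there is C with ∫|V||u|² ≤ ε‖∇u‖² + C‖u‖² on
H¹ (`IsKatoClass.exists_form_bound`). Taking ε = 1/2 gives the two-sided bounds; integrability and
semiboundedness follow.

The estimate is a TT* argument. Let A = ∫_E |V||u|², with E a truncation set making A finite, and h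
= 1_E |V| u, so that A = ⟨h, u⟩. Cauchy–Schwarz on the Fourier side with weight λ + 4π²|ξ|² gives A²
≤ (λ‖u‖² + ‖∇u‖²) ∫ |ĥ|²/(λ + 4π²|ξ|²), and the last integral is at most ∬ |h(x)||h(y)| G_λ(x − y),
where G_λ is the Green function of λ − Δ (`enorm_integral_conj_mul_sq_le`). By a Schur test
(`lintegral_lintegral_symm_mul_le`) the double integral is at most ηA, with η any bound for sup_x
∫|V(y)| G_λ(x − y) dy. Dividing by A leaves A ≤ η(λ‖u‖² + ‖∇u‖²).

The Kato condition makes η small for large λ (`IsKatoClass.exists_lintegral_green_le`): near the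
diagonal G_λ(z) ≤ 8/|z| uniformly in λ, and away from it G_λ(z) ≤ c(λ)|z|⁻⁴ with c(λ) → 0. Writing
G_λ as a Laplace transform of heat kernels reduces each fact about it to Gaussians.

For closedness, the lower bound makes the partial derivatives Cauchy in L²; their limits are the
distributional derivatives of u, hence u ∈ H¹, and the upper bound gives convergence in the form. -/

namespace KatoForm

open FourierTransform

/-! ### Fourier description of H¹ and Plancherel for the gradient -/

section Fourier

theorem ae_eq_of_forall_integral_schwartz_eq {f g : R3 → ℂ} (hf : LocallyIntegrable f volume)
    (hg : LocallyIntegrable g volume)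
    (h : ∀ φ : 𝓢(R3, ℂ), ∫ x, φ x * f x = ∫ x, φ x * g x) : f =ᵐ[volume] g := by
  apply ae_eq_of_integral_contDiff_smul_eq hf hg
  intro ψ hψ hψc
  have h₁ : HasCompactSupport (Complex.ofRealCLM ∘ ψ) := hψc.comp_left rfl
  have h₂ : ContDiff ℝ ((⊤ : ℕ∞) : WithTop ℕ∞) (Complex.ofRealCLM ∘ ψ) := by fun_prop
  simpa using h (h₁.toSchwartzMap h₂)

theorem toTemperedDistribution_injective {f g : L2} (h : (f : 𝓢'(R3, ℂ)) = (g : 𝓢'(R3, ℂ))) :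
    f = g := by
  have := LinearMap.ker_eq_bot.mp
    (Lp.ker_toTemperedDistributionCLM_eq_bot (F := ℂ) (μ := (volume : Measure R3)) (p := 2))
  exact this (by simpa using h)

theorem locallyIntegrable_coeFn (f : L2) : LocallyIntegrable f volume :=
  (Lp.memLp f).locallyIntegrable (by norm_num)

/-- Links the L² Fourier transform to the integral one. Both sides are locally integrable, so it
suffices to test against Schwartz functions, where the transform can be moved onto the test
function. -/
theorem fourier_toLp_ae {h : R3 → ℂ} (h1 : Integrable h) (h2 : MemLp h 2) :
    (𝓕 (h2.toLp h : L2) : L2) =ᵐ[volume] 𝓕 h := by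
  have hc : Continuous (𝓕 h) := VectorFourier.fourierIntegral_continuous
    Real.continuous_fourierChar (innerSL ℝ).continuous₂ h1
  apply ae_eq_of_forall_integral_schwartz_eq (locallyIntegrable_coeFn _) hc.locallyIntegrable
  intro φ
  have e := Lp.fourier_toTemperedDistribution_eq (h2.toLp h : L2)
  have e' := congrArg (fun T : 𝓢'(R3, ℂ) => T φ) e
  simp only [TemperedDistribution.fourier_apply, Lp.toTemperedDistribution_apply,
    smul_eq_mul] at e'
  rw [← e']
  have := VectorFourier.integral_fourierIntegral_smul_eq_flip (L := innerₗ R3)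
    (μ := volume) (ν := volume) (f := φ) (g := h)
    Real.continuous_fourierChar continuous_inner φ.integrable h1
  simp only [flip_innerₗ, smul_eq_mul] at this
  trans ∫ x, (𝓕 φ) x * h x
  · apply integral_congr_ae
    filter_upwards [h2.coeFn_toLp] with x hx
    rw [hx]
  · rw [SchwartzMap.fourier_coe]
    exact this

theorem fourier_partialDeriv_ae (i : Fin 3) (u : H1) :
    (𝓕 (partialDeriv i u) : L2) =ᵐ[volume]
      fun ξ => 2 * Real.pi * Complex.I * (ξ i) * (𝓕 (u : L2) : L2) ξ := by
  have hc : Continuous fun ξ : R3 => 2 * Real.pi * Complex.I * ((ξ i : ℝ) : ℂ) := by fun_prop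
  have hL : LocallyIntegrable
      (fun ξ : R3 => 2 * Real.pi * Complex.I * (ξ i) * (𝓕 (u : L2) : L2) ξ) volume := by
    have := (locallyIntegrable_coeFn (𝓕 (u : L2) : L2)).locallyIntegrableOn Set.univ
    have := this.continuousOn_smul isOpen_univ.isLocallyClosed hc.continuousOn
    simpa [locallyIntegrableOn_univ] using this
  apply ae_eq_of_forall_integral_schwartz_eq (locallyIntegrable_coeFn _) hL
  intro φ
  have e := congrArg (fun T : 𝓢'(R3, ℂ) => (𝓕 T) φ) (partialDeriv_spec i u)
  simp only [TemperedDistribution.fourier_lineDerivOp_eq, Lp.fourier_toTemperedDistribution_eq] at e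
  have hg : (fun x : R3 => ((inner ℝ x (EuclideanSpace.single i (1 : ℝ) : R3) : ℝ) : ℂ)).HasTemperateGrowth := by
    fun_prop
  simp only [Lp.toTemperedDistribution_apply, smul_eq_mul] at e
  rw [← e]
  change (2 * Real.pi * Complex.I) • (TemperedDistribution.smulLeftCLM ℂ _ _) φ = _
  rw [TemperedDistribution.smulLeftCLM_apply_apply, Lp.toTemperedDistribution_apply, smul_eq_mul,
    ← integral_const_mul]
  congr 1
  ext x
  rw [SchwartzMap.smulLeftCLM_apply_apply hg]
  simp [EuclideanSpace.inner_single_right]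
  ring

theorem lintegral_enorm_sq (f : L2) : ∫⁻ x, ‖f x‖ₑ ^ 2 = ‖f‖ₑ ^ 2 := by
  rw [Lp.enorm_def, eLpNorm_eq_lintegral_rpow_enorm_toReal (by norm_num) (by norm_num)]
  simp only [ENNReal.toReal_ofNat, ENNReal.rpow_two]
  rw [← ENNReal.rpow_two, ← ENNReal.rpow_mul]
  norm_num

theorem lintegral_enorm_sq_eq_ofReal (f : L2) :
    ∫⁻ x, ‖f x‖ₑ ^ 2 = ENNReal.ofReal (‖f‖ ^ 2) := by
  rw [lintegral_enorm_sq, ENNReal.ofReal_pow (norm_nonneg _), ofReal_norm]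

/-- The symbol `lam + 4π²|ξ|²` of `lam - Δ`. -/
noncomputable def symb (lam : ℝ) (ξ : R3) : ℝ := lam + 4 * Real.pi ^ 2 * ‖ξ‖ ^ 2

/-- Plancherel applied to u and to each ∂ᵢu, whose transform is 2πiξᵢû. -/
theorem lintegral_fourier_symb {lam : ℝ} (hl : 0 ≤ lam) (u : H1) :
    ∫⁻ ξ, ENNReal.ofReal (symb lam ξ) * ‖(𝓕 (u : L2) : L2) ξ‖ₑ ^ 2 =
      ENNReal.ofReal (lam * ‖(u : L2)‖ ^ 2 + gradNormSq u) := by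
  have hm : AEMeasurable (fun ξ => ‖(𝓕 (u : L2) : L2) ξ‖ₑ ^ 2) volume :=
    (Lp.aestronglyMeasurable _).enorm.pow_const 2
  have hi (i : Fin 3) : ∫⁻ ξ : R3, ENNReal.ofReal (4 * Real.pi ^ 2 * (ξ i) ^ 2) *
      ‖(𝓕 (u : L2) : L2) ξ‖ₑ ^ 2 = ENNReal.ofReal (‖partialDeriv i u‖ ^ 2) := by
    rw [← Lp.norm_fourier_eq, ← lintegral_enorm_sq_eq_ofReal]
    apply lintegral_congr_ae
    filter_upwards [fourier_partialDeriv_ae i u] with ξ hξ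
    rw [hξ, enorm_mul, mul_pow]
    congr 1
    rw [← ofReal_norm, ← ENNReal.ofReal_pow (norm_nonneg _)]
    congr 1
    simp [abs_of_pos Real.pi_pos, mul_pow]
    norm_num
  have hs (ξ : R3) : ENNReal.ofReal (symb lam ξ) * ‖(𝓕 (u : L2) : L2) ξ‖ₑ ^ 2 =
      ENNReal.ofReal lam * ‖(𝓕 (u : L2) : L2) ξ‖ₑ ^ 2 +
      ∑ i : Fin 3, ENNReal.ofReal (4 * Real.pi ^ 2 * (ξ i) ^ 2) *
        ‖(𝓕 (u : L2) : L2) ξ‖ₑ ^ 2 := by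
    rw [symb, ENNReal.ofReal_add hl (by positivity), add_mul, ← Finset.sum_mul,
      ← ENNReal.ofReal_sum_of_nonneg (fun _ _ => by positivity), ← Finset.mul_sum,
      EuclideanSpace.real_norm_sq_eq]
  simp_rw [hs]
  rw [lintegral_add_left' (hm.const_mul _), lintegral_finsetSum' _ (fun i _ => ?_),
    lintegral_const_mul'' _ hm, lintegral_enorm_sq_eq_ofReal, Lp.norm_fourier_eq]
  · simp_rw [hi]
    rw [← ENNReal.ofReal_sum_of_nonneg (fun _ _ => by positivity),
      ← ENNReal.ofReal_mul hl, ← ENNReal.ofReal_add (by positivity) (Finset.sum_nonneg fun _ _ => by positivity)]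
    rfl
  · refine AEMeasurable.mul (Measurable.aemeasurable ?_) hm
    fun_prop

end Fourier

/-! ### The Green function and the energy inequality -/

section Green

/-- The heat kernel on `ℝ³`. -/
noncomputable def heat (t : ℝ) (z : R3) : ℝ :=
  (4 * Real.pi * t) ^ (-(3 / 2) : ℝ) * Real.exp (-‖z‖ ^ 2 / (4 * t))

/-- The Green function of `lam - Δ` on `ℝ³`, as a Laplace transform of the heat kernel. -/
noncomputable def green (lam : ℝ) (z : R3) : ℝ≥0∞ :=
  ∫⁻ t in Set.Ioi 0, ENNReal.ofReal (Real.exp (-lam * t) * heat t z)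

theorem measurable_heat : Measurable (fun p : ℝ × R3 => heat p.1 p.2) := by
  unfold heat
  fun_prop

theorem measurable_green (lam : ℝ) : Measurable (green lam) := by
  unfold green
  refine Measurable.lintegral_prod_right' (f := fun p : R3 × ℝ =>
    ENNReal.ofReal (Real.exp (-lam * p.2) * heat p.2 p.1)) ?_
  have := measurable_heat.comp measurable_swap (α := R3 × ℝ)
  simp only [Function.comp_def, Prod.fst_swap, Prod.snd_swap] at this
  fun_prop

theorem heat_nonneg {t : ℝ} (ht : 0 < t) (z : R3) : 0 ≤ heat t z := by
  unfold heat; positivity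

theorem green_neg (lam : ℝ) (z : R3) : green lam (-z) = green lam z := by
  simp [green, heat]

theorem continuous_fourier {h : R3 → ℂ} (hh : Integrable h) : Continuous (𝓕 h) :=
  VectorFourier.fourierIntegral_continuous Real.continuous_fourierChar
    (innerSL ℝ).continuous₂ hh

theorem integrable_gaussian {b : ℝ} (hb : 0 < b) (x : R3) : Integrable
    (fun ξ : R3 => Complex.exp (-b * ‖ξ‖ ^ 2 + 2 * Real.pi * Complex.I * (inner ℝ x ξ : ℝ))) := by
  have := GaussianFourier.integrable_cexp_neg_mul_sq_norm_add (b := b) (V := R3) (by simpa)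
    (2 * Real.pi * Complex.I) x
  simpa using this

theorem norm_fourierInv_gaussian {t : ℝ} (ht : 0 < t) (x y : R3) :
    ‖𝓕⁻ (fun ξ : R3 => Complex.exp (-(4 * Real.pi ^ 2 * t : ℝ) * ‖ξ‖ ^ 2 +
      2 * Real.pi * Complex.I * (inner ℝ (-x) ξ : ℝ))) y‖ = heat t (x - y) := by
  have hb : 0 < 4 * Real.pi ^ 2 * t := by positivity
  rw [Real.fourierInv_eq_fourier_neg, fourier_gaussian_innerProductSpace' (by rwa [Complex.ofReal_re]), heat,
    norm_mul, Complex.norm_exp]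
  congr 1
  · have : ((Real.pi : ℂ) / ((4 * Real.pi ^ 2 * t : ℝ) : ℂ)) =
      (((4 * Real.pi * t)⁻¹ : ℝ) : ℂ) := by
      push_cast
      have : (Real.pi : ℂ) ≠ 0 := by exact_mod_cast Real.pi_ne_zero
      have : (t : ℂ) ≠ 0 := by exact_mod_cast ht.ne'
      field_simp
    rw [this, Complex.norm_cpow_eq_rpow_re_of_pos (by positivity), Real.inv_rpow (by positivity),
      ← Real.rpow_neg (by positivity)]
    simp
  · rw [show -x - -y = -(x - y) by abel, norm_neg]
    have : (-(Real.pi : ℂ) ^ 2 * (‖x - y‖ : ℂ) ^ 2 / ((4 * Real.pi ^ 2 * t : ℝ) : ℂ)) =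
      ((-‖x - y‖ ^ 2 / (4 * t) : ℝ) : ℂ) := by
      push_cast
      have : (Real.pi : ℂ) ≠ 0 := by exact_mod_cast Real.pi_ne_zero
      have : (t : ℂ) ≠ 0 := by exact_mod_cast ht.ne'
      field_simp
    rw [this, Complex.ofReal_re]

/-- Absorbing the character at x into the Gaussian and moving the transform from h onto it turns the
left side into the convolution of conj h with the heat kernel, up to absolute values. -/
theorem enorm_fourier_conj_gaussian_le {h : R3 → ℂ} (hh : Integrable h) {t : ℝ} (ht : 0 < t)
    (x : R3) :
    ‖𝓕 (fun ξ => conj (𝓕 h ξ) * Complex.exp (-(4 * Real.pi ^ 2 * t : ℝ) * ‖ξ‖ ^ 2)) x‖ₑ ≤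
      ∫⁻ y, ‖h y‖ₑ * ENNReal.ofReal (heat t (x - y)) := by
  have hb : 0 < 4 * Real.pi ^ 2 * t := by positivity
  have key := VectorFourier.integral_sesq_fourierIntegral_eq_neg_flip (L := innerₗ R3)
    (μ := volume) (ν := volume) (f := h) (innerSL ℂ)
    (g := fun ξ : R3 => Complex.exp (-(4 * Real.pi ^ 2 * t : ℝ) * ‖ξ‖ ^ 2 +
      2 * Real.pi * Complex.I * (inner ℝ (-x) ξ : ℝ)))
    Real.continuous_fourierChar continuous_inner hh (integrable_gaussian hb (-x))
  have e : 𝓕 (fun ξ => conj (𝓕 h ξ) * Complex.exp (-(4 * Real.pi ^ 2 * t : ℝ) * ‖ξ‖ ^ 2)) x =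
      ∫ y, conj (h y) * 𝓕⁻ (fun ξ : R3 => Complex.exp (-(4 * Real.pi ^ 2 * t : ℝ) * ‖ξ‖ ^ 2 +
      2 * Real.pi * Complex.I * (inner ℝ (-x) ξ : ℝ))) y := by
    rw [Real.fourier_eq']
    refine Eq.trans ?_ (key.trans ?_)
    · congr 1
      ext ξ
      simp only [smul_eq_mul, innerSL_apply_apply, RCLike.inner_apply]
      rw [Complex.exp_add, mul_comm, mul_assoc]
      change _ = _ * conj (𝓕 h ξ)
      rw [mul_comm (conj _)]
      congr 2
      rw [inner_neg_left, real_inner_comm]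
      push_cast
      ring_nf
    · congr 1
      ext y
      simp only [innerSL_apply_apply, RCLike.inner_apply, flip_innerₗ]
      rw [mul_comm]
      rfl
  rw [e]
  refine (enorm_integral_le_lintegral_enorm _).trans (le_of_eq ?_)
  congr 1
  ext y
  rw [enorm_mul, ← norm_fourierInv_gaussian ht, ofReal_norm]
  simp

/-- Write |ĥ|² = ĥ · conj ĥ and move the first transform across. The Gaussian factor makes the
remaining function integrable although ĥ is only known to be bounded. -/
theorem lintegral_gaussian_fourier_le {h : R3 → ℂ} (hh : Integrable h) {t : ℝ} (ht : 0 < t) :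
    ∫⁻ ξ, ENNReal.ofReal (Real.exp (-(4 * Real.pi ^ 2 * t) * ‖ξ‖ ^ 2)) * ‖𝓕 h ξ‖ₑ ^ 2 ≤
      ∫⁻ x, ∫⁻ y, ‖h x‖ₑ * ‖h y‖ₑ * ENNReal.ofReal (heat t (x - y)) := by
  have hb : 0 < 4 * Real.pi ^ 2 * t := by positivity
  have hc := continuous_fourier hh
  have hg : Integrable (fun ξ : R3 => Complex.exp (-(4 * Real.pi ^ 2 * t : ℝ) * ‖ξ‖ ^ 2)) := by
    simpa using integrable_gaussian hb 0
  have hbd (ξ : R3) : ‖𝓕 h ξ‖ ≤ ∫ v, ‖h v‖ :=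
    VectorFourier.norm_fourierIntegral_le_integral_norm _ _ _ _ _
  have hG : Integrable (fun ξ => conj (𝓕 h ξ) *
      Complex.exp (-(4 * Real.pi ^ 2 * t : ℝ) * ‖ξ‖ ^ 2)) := by
    refine hg.bdd_mul (c := ∫ v, ‖h v‖) ?_ ?_
    · exact (Complex.continuous_conj.comp hc).aestronglyMeasurable
    · exact Eventually.of_forall fun ξ => by simpa using hbd ξ
  have hG2 : Integrable (fun ξ => 𝓕 h ξ * (conj (𝓕 h ξ) *
      Complex.exp (-(4 * Real.pi ^ 2 * t : ℝ) * ‖ξ‖ ^ 2))) :=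
    hG.bdd_mul (c := ∫ v, ‖h v‖) hc.aestronglyMeasurable (Eventually.of_forall hbd)
  have hE (ξ : R3) : 𝓕 h ξ * (conj (𝓕 h ξ) *
      Complex.exp (-(4 * Real.pi ^ 2 * t : ℝ) * ‖ξ‖ ^ 2)) =
      ((Real.exp (-(4 * Real.pi ^ 2 * t) * ‖ξ‖ ^ 2) * ‖𝓕 h ξ‖ ^ 2 : ℝ) : ℂ) := by
    rw [← mul_assoc, Complex.mul_conj, Complex.normSq_eq_norm_sq]
    push_cast
    ring
  have key := VectorFourier.integral_fourierIntegral_smul_eq_flip (L := innerₗ R3)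
    (μ := volume) (ν := volume) (f := h) (g := fun ξ => conj (𝓕 h ξ) *
      Complex.exp (-(4 * Real.pi ^ 2 * t : ℝ) * ‖ξ‖ ^ 2))
    Real.continuous_fourierChar continuous_inner hh hG
  have hR : Integrable (fun ξ => Real.exp (-(4 * Real.pi ^ 2 * t) * ‖ξ‖ ^ 2) * ‖𝓕 h ξ‖ ^ 2) := by
    simp_rw [hE] at hG2
    exact hG2.re
  calc _ = ENNReal.ofReal (∫ ξ, Real.exp (-(4 * Real.pi ^ 2 * t) * ‖ξ‖ ^ 2) * ‖𝓕 h ξ‖ ^ 2) := by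
        rw [ofReal_integral_eq_lintegral_ofReal hR
          (Eventually.of_forall fun ξ => by positivity)]
        congr 1
        ext ξ
        rw [ENNReal.ofReal_mul (by positivity), ENNReal.ofReal_pow (by positivity), ofReal_norm]
    _ = ‖∫ ξ, 𝓕 h ξ * (conj (𝓕 h ξ) *
      Complex.exp (-(4 * Real.pi ^ 2 * t : ℝ) * ‖ξ‖ ^ 2))‖ₑ := by
        simp_rw [hE]
        rw [integral_complex_ofReal, ← ofReal_norm, Complex.norm_real, Real.norm_of_nonneg]
        exact integral_nonneg fun ξ => by positivity
    _ = ‖∫ x, h x * 𝓕 (fun ξ => conj (𝓕 h ξ) *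
      Complex.exp (-(4 * Real.pi ^ 2 * t : ℝ) * ‖ξ‖ ^ 2)) x‖ₑ := by
        congr 1
        simp only [flip_innerₗ, smul_eq_mul] at key
        exact key
    _ ≤ _ := by
        refine (enorm_integral_le_lintegral_enorm _).trans ?_
        gcongr with x
        rw [enorm_mul]
        simp_rw [mul_assoc ‖h x‖ₑ]
        rw [lintegral_const_mul']
        · gcongr
          exact enorm_fourier_conj_gaussian_le hh ht x
        · simp

theorem symb_pos {lam : ℝ} (hl : 0 < lam) (ξ : R3) : 0 < symb lam ξ := by
  unfold symb; positivity

theorem lintegral_exp_neg {s : ℝ} (hs : 0 < s) :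
    ∫⁻ t in Set.Ioi (0 : ℝ), ENNReal.ofReal (Real.exp (-s * t)) = (ENNReal.ofReal s)⁻¹ := by
  rw [← ofReal_integral_eq_lintegral_ofReal (integrableOn_exp_mul_Ioi (by linarith) 0)
    (Eventually.of_forall fun t => by positivity), integral_exp_mul_Ioi (by linarith),
    ← ENNReal.ofReal_inv_of_pos hs]
  congr 1
  simp [neg_div_neg_eq]

/-- Since 1/s = ∫₀^∞ e^{-st} dt, this is the Gaussian inequality integrated in t against e^{-λt}.
All integrands are nonnegative, so Tonelli applies with no finiteness to check. -/
theorem lintegral_resolvent_fourier_le {h : R3 → ℂ} (hh : Integrable h) {lam : ℝ} (hl : 0 < lam) :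
    ∫⁻ ξ, (ENNReal.ofReal (symb lam ξ))⁻¹ * ‖𝓕 h ξ‖ₑ ^ 2 ≤
      ∫⁻ x, ∫⁻ y, ‖h x‖ₑ * ‖h y‖ₑ * green lam (x - y) := by
  have hc := continuous_fourier hh
  have hm := hh.aestronglyMeasurable.enorm
  have hmeas : Measurable (fun p : (R3 × R3) × ℝ => Real.exp (-lam * p.2) * heat p.2 (p.1.1 - p.1.2)) := by
    have := measurable_heat.comp (f := fun p : (R3 × R3) × ℝ => (p.2, p.1.1 - p.1.2))
      (by fun_prop)
    simp only [Function.comp_def] at this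
    fun_prop
  calc _ = ∫⁻ ξ, ∫⁻ t in Set.Ioi (0 : ℝ),
        ENNReal.ofReal (Real.exp (-symb lam ξ * t)) * ‖𝓕 h ξ‖ₑ ^ 2 := by
        congr 1; ext ξ
        rw [lintegral_mul_const' _ _ (by simp), lintegral_exp_neg (symb_pos hl ξ)]
    _ = ∫⁻ t in Set.Ioi (0 : ℝ), ∫⁻ ξ,
        ENNReal.ofReal (Real.exp (-symb lam ξ * t)) * ‖𝓕 h ξ‖ₑ ^ 2 := by
        refine lintegral_lintegral_swap (Measurable.aemeasurable ?_)
        have := hc.measurable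
        unfold Function.uncurry symb
        fun_prop
    _ ≤ ∫⁻ t in Set.Ioi (0 : ℝ), ENNReal.ofReal (Real.exp (-lam * t)) *
          ∫⁻ x, ∫⁻ y, ‖h x‖ₑ * ‖h y‖ₑ * ENNReal.ofReal (heat t (x - y)) := by
        refine setLIntegral_mono' measurableSet_Ioi fun t ht => ?_
        refine le_trans (le_of_eq ?_) (mul_le_mul_right (lintegral_gaussian_fourier_le hh ht) _)
        rw [← lintegral_const_mul' _ _ (by simp)]
        congr 1; ext ξ
        rw [← mul_assoc, ← ENNReal.ofReal_mul (by positivity), ← Real.exp_add, symb]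
        ring_nf
    _ = ∫⁻ t in Set.Ioi (0 : ℝ), ∫⁻ p : R3 × R3, ‖h p.1‖ₑ * ‖h p.2‖ₑ *
          ENNReal.ofReal (Real.exp (-lam * t) * heat t (p.1 - p.2)) := by
        refine setLIntegral_congr_fun measurableSet_Ioi fun t ht => ?_
        rw [Measure.volume_eq_prod, lintegral_prod, ← lintegral_const_mul' _ _ (by simp)]
        · congr 1; ext x
          rw [← lintegral_const_mul' _ _ (by simp)]
          congr 1; ext y
          rw [ENNReal.ofReal_mul (by positivity)]
          ring
        · have := hmeas.comp (f := fun p : R3 × R3 => (p, t)) (by fun_prop)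
          simp only [Function.comp_def] at this
          exact (hm.comp_fst.mul hm.comp_snd).mul this.ennreal_ofReal.aemeasurable
    _ = ∫⁻ p : R3 × R3, ∫⁻ t in Set.Ioi (0 : ℝ), ‖h p.1‖ₑ * ‖h p.2‖ₑ *
          ENNReal.ofReal (Real.exp (-lam * t) * heat t (p.1 - p.2)) := by
        refine (lintegral_lintegral_swap ?_).symm
        exact (hm.comp_fst.mul hm.comp_snd).comp_fst.mul hmeas.ennreal_ofReal.aemeasurable
    _ = ∫⁻ p : R3 × R3, ‖h p.1‖ₑ * ‖h p.2‖ₑ * green lam (p.1 - p.2) := by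
        congr 1; ext p
        rw [lintegral_const_mul', green]
        exact ENNReal.mul_ne_top (by simp) (by simp)
    _ = _ := by
        rw [Measure.volume_eq_prod, lintegral_prod]
        refine (hm.comp_fst.mul hm.comp_snd).mul (Measurable.aemeasurable ?_)
        have := measurable_green lam
        fun_prop

theorem enorm_integral_conj_mul_sq_le {h : R3 → ℂ} (h1 : Integrable h) (h2 : MemLp h 2)
    {lam : ℝ} (hl : 0 < lam) (u : H1) :
    ‖∫ x, conj (h x) * (u : L2) x‖ₑ ^ 2 ≤
      ENNReal.ofReal (lam * ‖(u : L2)‖ ^ 2 + gradNormSq u) *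
        ∫⁻ x, ∫⁻ y, ‖h x‖ₑ * ‖h y‖ₑ * green lam (x - y) := by
  have e1 : ∫ x, conj (h x) * (u : L2) x = inner ℂ (h2.toLp h : L2) (u : L2) := by
    rw [L2.inner_def]
    apply integral_congr_ae
    filter_upwards [h2.coeFn_toLp] with x hx
    rw [hx, RCLike.inner_apply, mul_comm]
  set U : L2 := 𝓕 (u : L2) with hU
  have hUm : AEMeasurable (fun ξ => ‖U ξ‖ₑ) volume := (Lp.aestronglyMeasurable _).enorm
  have hFm : AEMeasurable (fun ξ => ‖𝓕 h ξ‖ₑ) volume :=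
    (continuous_fourier h1).aestronglyMeasurable.enorm
  have hsm : Measurable (fun ξ => ENNReal.ofReal (symb lam ξ) ^ (1 / 2 : ℝ)) := by
    unfold symb; fun_prop
  have e2 : ‖∫ x, conj (h x) * (u : L2) x‖ₑ ≤ ∫⁻ ξ, ‖𝓕 h ξ‖ₑ * ‖U ξ‖ₑ := by
    rw [e1, ← Lp.inner_fourier_eq, L2.inner_def]
    refine (enorm_integral_le_lintegral_enorm _).trans (le_of_eq ?_)
    apply lintegral_congr_ae
    filter_upwards [fourier_toLp_ae h1 h2] with ξ hξ
    rw [hξ, RCLike.inner_apply, enorm_mul, mul_comm]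
    simp [hU]
  -- The weight is split as symb^{1/2} · symb^{-1/2}: the first factor yields the H¹ energy of u,
  -- the second the Green energy of h.
  have cs := ENNReal.lintegral_mul_le_Lp_mul_Lq (volume : Measure R3)
    (f := fun ξ => ENNReal.ofReal (symb lam ξ) ^ (1 / 2 : ℝ) * ‖U ξ‖ₑ)
    (g := fun ξ => (ENNReal.ofReal (symb lam ξ) ^ (1 / 2 : ℝ))⁻¹ * ‖𝓕 h ξ‖ₑ)
    (Real.HolderConjugate.two_two) (hsm.aemeasurable.mul hUm) (hsm.inv.aemeasurable.mul hFm)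
  have e3 : ∫⁻ ξ, ‖𝓕 h ξ‖ₑ * ‖U ξ‖ₑ =
      ∫⁻ ξ, ((fun ξ => ENNReal.ofReal (symb lam ξ) ^ (1 / 2 : ℝ) * ‖U ξ‖ₑ) *
        (fun ξ => (ENNReal.ofReal (symb lam ξ) ^ (1 / 2 : ℝ))⁻¹ * ‖𝓕 h ξ‖ₑ)) ξ := by
    congr 1; ext ξ
    have hs := symb_pos hl ξ
    have h0 : ENNReal.ofReal (symb lam ξ) ^ (1 / 2 : ℝ) ≠ 0 := by
      simp [ENNReal.rpow_eq_zero_iff, hs]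
    have ht : ENNReal.ofReal (symb lam ξ) ^ (1 / 2 : ℝ) ≠ ∞ := by
      simp [ENNReal.rpow_eq_top_iff]
    simp only [Pi.mul_apply]
    rw [mul_mul_mul_comm, ENNReal.mul_inv_cancel h0 ht, one_mul, mul_comm]
  have hsq (a b : ℝ≥0∞) : (a ^ (1 / 2 : ℝ) * b) ^ (2 : ℝ) = a * b ^ 2 := by
    rw [ENNReal.mul_rpow_of_nonneg _ _ (by norm_num), ← ENNReal.rpow_mul]
    norm_num
  calc _ ≤ (∫⁻ ξ, ‖𝓕 h ξ‖ₑ * ‖U ξ‖ₑ) ^ 2 := by gcongr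
    _ ≤ ((∫⁻ ξ, (ENNReal.ofReal (symb lam ξ) ^ (1 / 2 : ℝ) * ‖U ξ‖ₑ) ^ (2 : ℝ)) ^ (1 / 2 : ℝ) *
        (∫⁻ ξ, ((ENNReal.ofReal (symb lam ξ) ^ (1 / 2 : ℝ))⁻¹ * ‖𝓕 h ξ‖ₑ) ^ (2 : ℝ)) ^
          (1 / 2 : ℝ)) ^ 2 := by
      rw [e3]
      exact pow_le_pow_left' cs 2
    _ = (∫⁻ ξ, ENNReal.ofReal (symb lam ξ) * ‖U ξ‖ₑ ^ 2) *
        ∫⁻ ξ, (ENNReal.ofReal (symb lam ξ))⁻¹ * ‖𝓕 h ξ‖ₑ ^ 2 := by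
      rw [mul_pow, ← ENNReal.rpow_two, ← ENNReal.rpow_two, ← ENNReal.rpow_mul,
        ← ENNReal.rpow_mul]
      simp_rw [← ENNReal.inv_rpow, hsq]
      norm_num
    _ ≤ _ := by
      rw [lintegral_fourier_symb hl.le]
      exact mul_le_mul_right (lintegral_resolvent_fourier_le h1 hl) _

end Green

/-! ### Smallness of the Green potential of a Kato class function -/

section Kato

theorem heat_eq {t : ℝ} (ht : 0 < t) (z : R3) : heat t z =
    (4 * Real.pi) ^ (-(3 / 2) : ℝ) * (t ^ (-(3 / 2) : ℝ) * Real.exp (-(‖z‖ ^ 2 / 4) / t)) := by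
  rw [heat, Real.mul_rpow (by positivity) ht.le, mul_assoc]
  congr 3
  field_simp

theorem heat_le {t : ℝ} (ht : 0 < t) (z : R3) : heat t z ≤
    t ^ (-(3 / 2) : ℝ) * Real.exp (-(‖z‖ ^ 2 / 4) / t) := by
  rw [heat_eq ht]
  refine mul_le_of_le_one_left (by positivity) ?_
  exact Real.rpow_le_one_of_one_le_of_nonpos (by linarith [Real.pi_gt_three]) (by norm_num)

/-- Split at t = b. Below b use e^{-b/t} ≤ t/b, above b use e^{-b/t} ≤ 1; each half contributes
2b^{-1/2}. -/
theorem lintegral_rpow_mul_exp_neg_div_le {b : ℝ} (hb : 0 < b) :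
    ∫⁻ t in Set.Ioi (0 : ℝ), ENNReal.ofReal (t ^ (-(3 / 2) : ℝ) * Real.exp (-b / t)) ≤
      ENNReal.ofReal (4 * b ^ (-(1 / 2) : ℝ)) := by
  have h1 : ∫⁻ t in Set.Ioc (0 : ℝ) b,
      ENNReal.ofReal (t ^ (-(3 / 2) : ℝ) * Real.exp (-b / t)) ≤
      ENNReal.ofReal (2 * b ^ (-(1 / 2) : ℝ)) := by
    have hi : IntegrableOn (fun t : ℝ => b⁻¹ * t ^ (-(1 / 2) : ℝ)) (Set.Ioc 0 b) := by
      refine Integrable.const_mul ?_ _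
      have := intervalIntegral.intervalIntegrable_rpow' (a := 0) (b := b) (r := -(1 / 2))
        (by norm_num)
      rwa [intervalIntegrable_iff_integrableOn_Ioc_of_le hb.le] at this
    calc _ ≤ ∫⁻ t in Set.Ioc (0 : ℝ) b, ENNReal.ofReal (b⁻¹ * t ^ (-(1 / 2) : ℝ)) := by
          refine setLIntegral_mono' measurableSet_Ioc fun t ht => ENNReal.ofReal_le_ofReal ?_
          have ht0 : 0 < t := ht.1
          have e : Real.exp (-b / t) ≤ b⁻¹ * t := by
            rw [neg_div, Real.exp_neg, inv_le_comm₀ (by positivity) (by positivity), mul_inv,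
              inv_inv, ← div_eq_mul_inv]
            linarith [Real.add_one_le_exp (b / t)]
          calc _ ≤ t ^ (-(3 / 2) : ℝ) * (b⁻¹ * t) := by gcongr
            _ = b⁻¹ * t ^ (-(1 / 2) : ℝ) := by
              rw [show (-(1 / 2) : ℝ) = -(3 / 2) + 1 by norm_num, Real.rpow_add ht0,
                Real.rpow_one]
              ring
      _ = ENNReal.ofReal (2 * b ^ (-(1 / 2) : ℝ)) := by
          rw [← ofReal_integral_eq_lintegral_ofReal hi ?_, integral_const_mul,
            ← intervalIntegral.integral_of_le hb.le, integral_rpow (Or.inl (by norm_num))]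
          · congr 1
            rw [Real.zero_rpow (by norm_num), show (-(1 / 2) : ℝ) + 1 = 1 / 2 by norm_num,
              show (-(1 / 2) : ℝ) = 1 / 2 - 1 by norm_num, Real.rpow_sub hb, Real.rpow_one]
            field_simp
            ring
          · filter_upwards [ae_restrict_mem measurableSet_Ioc] with t ht
            have := ht.1
            positivity
  have h2 : ∫⁻ t in Set.Ioi b,
      ENNReal.ofReal (t ^ (-(3 / 2) : ℝ) * Real.exp (-b / t)) ≤
      ENNReal.ofReal (2 * b ^ (-(1 / 2) : ℝ)) := by
    calc _ ≤ ∫⁻ t in Set.Ioi b, ENNReal.ofReal (t ^ (-(3 / 2) : ℝ)) := by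
          refine setLIntegral_mono' measurableSet_Ioi fun t ht => ENNReal.ofReal_le_ofReal ?_
          have ht0 : 0 < t := hb.trans ht
          refine mul_le_of_le_one_right (by positivity) ?_
          rw [Real.exp_le_one_iff, neg_div]
          have : 0 < b / t := by positivity
          linarith
      _ = ENNReal.ofReal (2 * b ^ (-(1 / 2) : ℝ)) := by
          rw [← ofReal_integral_eq_lintegral_ofReal
            (integrableOn_Ioi_rpow_of_lt (by norm_num) hb) ?_,
            integral_Ioi_rpow_of_lt (by norm_num) hb]
          · congr 1
            norm_num
            ring
          · filter_upwards [ae_restrict_mem measurableSet_Ioi] with t ht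
            have : 0 < t := hb.trans ht
            positivity
  rw [← Set.Ioc_union_Ioi_eq_Ioi hb.le, lintegral_union measurableSet_Ioi
    (Set.Ioc_disjoint_Ioi le_rfl)]
  refine (add_le_add h1 h2).trans (le_of_eq ?_)
  rw [← ENNReal.ofReal_add (by positivity) (by positivity)]
  congr 1
  ring

theorem green_le_div {lam : ℝ} (hl : 0 ≤ lam) (z : R3) : green lam z ≤ 8 / ‖z‖ₑ := by
  rcases eq_or_ne z 0 with rfl | hz
  · simp [ENNReal.div_zero]
  have hz' : 0 < ‖z‖ := norm_pos_iff.mpr hz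
  calc green lam z ≤ ∫⁻ t in Set.Ioi (0 : ℝ),
        ENNReal.ofReal (t ^ (-(3 / 2) : ℝ) * Real.exp (-(‖z‖ ^ 2 / 4) / t)) := by
        refine setLIntegral_mono' measurableSet_Ioi fun t ht => ENNReal.ofReal_le_ofReal ?_
        have ht0 : 0 < t := ht
        refine le_trans ?_ (heat_le ht0 z)
        refine mul_le_of_le_one_left (heat_nonneg ht0 z) ?_
        rw [Real.exp_le_one_iff]
        nlinarith
    _ ≤ _ := lintegral_rpow_mul_exp_neg_div_le (by positivity)
    _ = 8 / ‖z‖ₑ := by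
        rw [← ofReal_norm, ← ENNReal.ofReal_ofNat 8, ← ENNReal.ofReal_div_of_pos hz']
        congr 1
        rw [show ‖z‖ ^ 2 / 4 = (‖z‖ / 2) ^ (2 : ℝ) by rw [Real.rpow_two]; ring,
          ← Real.rpow_mul (by positivity), show (2 : ℝ) * -(1 / 2) = -1 by norm_num,
          Real.rpow_neg_one]
        field_simp
        norm_num

/-- The constant in the decay estimate `green_le_decay`. -/
noncomputable def greenDecay (lam : ℝ) : ℝ := 32 * ((1 / lam) ^ (3 / 2 : ℝ) * Real.Gamma (3 / 2))

theorem green_le_decay {lam : ℝ} (hl : 0 < lam) {z : R3} (hz : z ≠ 0) :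
    green lam z ≤ ENNReal.ofReal (greenDecay lam) * ENNReal.ofReal ((‖z‖ ^ 4)⁻¹) := by
  have hz' : 0 < ‖z‖ := norm_pos_iff.mpr hz
  have hG := Real.integral_rpow_mul_exp_neg_mul_Ioi (a := 3 / 2) (r := lam) (by norm_num) hl
  have hpos : 0 < (1 / lam) ^ (3 / 2 : ℝ) * Real.Gamma (3 / 2) := by
    have := Real.Gamma_pos_of_pos (s := 3 / 2) (by norm_num)
    positivity
  have hint := Integrable.of_integral_ne_zero (hG.trans_ne hpos.ne')
  calc green lam z ≤ ∫⁻ t in Set.Ioi (0 : ℝ), ENNReal.ofReal (32 * (‖z‖ ^ 4)⁻¹ *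
        (t ^ (3 / 2 - 1 : ℝ) * Real.exp (-(lam * t)))) := by
        refine setLIntegral_mono' measurableSet_Ioi fun t ht => ENNReal.ofReal_le_ofReal ?_
        have ht0 : 0 < t := ht
        -- From e^s ≥ s²/2 with s = |z|²/(4t); the factor 32 is 2 · 4². The resulting t² makes the
        -- t-integral a Gamma integral.
        have e : Real.exp (-(‖z‖ ^ 2 / 4) / t) ≤ 32 * (‖z‖ ^ 4)⁻¹ * t ^ 2 := by
          have := Real.pow_div_factorial_le_exp (x := ‖z‖ ^ 2 / 4 / t) (by positivity) 2
          rw [neg_div, Real.exp_neg, inv_le_comm₀ (by positivity) (by positivity)]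
          refine le_trans (le_of_eq ?_) this
          norm_num [Nat.factorial]
          field_simp
          norm_num
        calc _ ≤ Real.exp (-lam * t) *
              (t ^ (-(3 / 2) : ℝ) * (32 * (‖z‖ ^ 4)⁻¹ * t ^ 2)) := by
              refine mul_le_mul_of_nonneg_left ((heat_le ht0 z).trans ?_) (by positivity)
              gcongr
          _ = _ := by
            rw [show (3 / 2 - 1 : ℝ) = -(3 / 2) + 2 by norm_num, Real.rpow_add ht0,
              Real.rpow_two, neg_mul]
            ring
    _ = _ := by
        rw [← ofReal_integral_eq_lintegral_ofReal (hint.const_mul _) ?_, integral_const_mul, hG,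
          ← ENNReal.ofReal_mul (by unfold greenDecay; positivity), greenDecay]
        · congr 1
          ring
        · filter_upwards [ae_restrict_mem measurableSet_Ioi] with t ht
          have : 0 < t := ht
          positivity

theorem tendsto_greenDecay : Tendsto greenDecay atTop (𝓝 0) := by
  unfold greenDecay
  have h : Tendsto (fun lam : ℝ => (1 / lam) ^ (3 / 2 : ℝ)) atTop (𝓝 0) := by
    refine (tendsto_rpow_neg_atTop (y := 3 / 2) (by norm_num)).congr' ?_
    filter_upwards [eventually_gt_atTop 0] with lam hl
    rw [one_div, Real.inv_rpow hl.le, Real.rpow_neg hl.le]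
  simpa using (h.mul_const (Real.Gamma (3 / 2))).const_mul 32

theorem setLIntegral_closedBall_le (W : R3 → ℝ≥0∞) {r : ℝ} (hr : 0 < r) (x : R3) :
    ∫⁻ y in Metric.closedBall x r, W y ≤
      ENNReal.ofReal r * ∫⁻ y in Metric.closedBall x r, W y / ‖x - y‖ₑ := by
  rw [← lintegral_const_mul' _ _ (by simp)]
  refine setLIntegral_mono' Metric.isClosed_closedBall.measurableSet fun y hy => ?_
  have hd : ‖x - y‖ₑ ≤ ENNReal.ofReal r := by
    rw [← ofReal_norm]
    refine ENNReal.ofReal_le_ofReal ?_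
    rwa [Metric.mem_closedBall, dist_comm, dist_eq_norm] at hy
  calc W y = ENNReal.ofReal r * (W y / ENNReal.ofReal r) :=
        (ENNReal.mul_div_cancel (by simpa using hr) (by simp)).symm
    _ ≤ _ := by gcongr

/-- A uniform bound on the mass of W in balls of radius r controls its tail against |x − y|⁻⁴:
average over centres w within r of y, replace the kernel by (1 + |x − w|)⁻⁴, and apply Tonelli. The
exponent 4 exceeds the dimension 3, so the w-integral converges. -/
theorem exists_far_bound {W : R3 → ℝ≥0∞} (hW : AEMeasurable W volume) {r : ℝ} (hr : 0 < r)
    {N : ℝ≥0∞} (hN : N ≠ ∞) (h : ∀ x, ∫⁻ y in Metric.closedBall x r, W y ≤ N) :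
    ∃ M : ℝ≥0∞, M ≠ ∞ ∧ ∀ x, ∫⁻ y in (Metric.closedBall x r)ᶜ,
      W y * ENNReal.ofReal ((‖x - y‖ ^ 4)⁻¹) ≤ M := by
  set B : ℝ≥0∞ := volume (Metric.closedBall (0 : R3) r) with hB
  have hB0 : B ≠ 0 := (Metric.measure_closedBall_pos volume _ hr).ne'
  have hBt : B ≠ ∞ := measure_closedBall_lt_top.ne
  set J : ℝ≥0∞ := ∫⁻ w : R3, ENNReal.ofReal ((1 + ‖w‖) ^ (-4 : ℝ)) with hJ
  have hJt : J ≠ ∞ := by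
    refine (finite_integral_one_add_norm (μ := (volume : Measure R3)) (r := 4) ?_).ne
    simp; norm_num
  set K : ℝ := (2 + 1 / r) ^ 4
  have hJx (x : R3) : ∫⁻ w : R3, ENNReal.ofReal ((1 + ‖x - w‖) ^ (-4 : ℝ)) = J :=
    lintegral_sub_left_eq_self (fun w : R3 => ENNReal.ofReal ((1 + ‖w‖) ^ (-4 : ℝ))) x
  refine ⟨B⁻¹ * (ENNReal.ofReal K * (J * N)), ?_, fun x => ?_⟩
  · exact ENNReal.mul_ne_top (by simpa using hB0)
      (ENNReal.mul_ne_top (by simp) (ENNReal.mul_ne_top hJt hN))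
  have hpt (y : R3) (hy : y ∈ (Metric.closedBall x r)ᶜ) :
      B * (W y * ENNReal.ofReal ((‖x - y‖ ^ 4)⁻¹)) ≤
        ∫⁻ w, ENNReal.ofReal K * (ENNReal.ofReal ((1 + ‖x - w‖) ^ (-4 : ℝ)) *
          (Metric.closedBall w r).indicator W y) := by
    have hy' : r < ‖x - y‖ := by
      simpa [dist_comm y x, dist_eq_norm] using hy
    have hB' : B = volume (Metric.closedBall y r) :=
      (Measure.addHaar_closedBall_center volume y r).symm
    rw [hB', mul_comm, ← setLIntegral_const, ← lintegral_indicator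
      Metric.isClosed_closedBall.measurableSet]
    refine lintegral_mono fun w => ?_
    by_cases hw : w ∈ Metric.closedBall y r
    swap
    · rw [Set.indicator_of_notMem hw]
      exact zero_le
    rw [Set.indicator_of_mem hw]
    have hw' : ‖y - w‖ ≤ r := by rwa [Metric.mem_closedBall, dist_comm, dist_eq_norm] at hw
    rw [Set.indicator_of_mem (by rwa [Metric.mem_closedBall, dist_eq_norm]), ← mul_assoc,
      mul_comm (W y), ← ENNReal.ofReal_mul (by positivity)]
    gcongr
    have h0 : 0 < ‖x - y‖ := hr.trans hy'
    have h1 : ‖x - w‖ ≤ ‖x - y‖ + ‖y - w‖ := norm_sub_le_norm_sub_add_norm_sub x y w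
    -- Both 1 ≤ |x − y|/r and |y − w| ≤ r ≤ |x − y| hold here, which is where K = (2 + 1/r)⁴ comes
    -- from.
    have h2 : 1 + ‖x - w‖ ≤ (2 + 1 / r) * ‖x - y‖ := by
      have : 1 ≤ 1 / r * ‖x - y‖ := by
        rw [one_div, inv_mul_eq_div, one_le_div hr]; exact hy'.le
      nlinarith
    rw [Real.rpow_neg (by positivity), ← div_eq_mul_inv, le_div_iff₀ (by positivity),
      inv_mul_le_iff₀ (by positivity), mul_comm, ← mul_pow]
    norm_cast
    exact pow_le_pow_left₀ (by positivity) h2 4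
  have hmeas : AEMeasurable (fun p : R3 × R3 => ENNReal.ofReal K *
      (ENNReal.ofReal ((1 + ‖x - p.2‖) ^ (-4 : ℝ)) *
          (Metric.closedBall p.2 r).indicator W p.1)) (volume.prod volume) := by
    refine AEMeasurable.const_mul (AEMeasurable.mul (Measurable.aemeasurable (by fun_prop)) ?_) _
    have hs : MeasurableSet {p : R3 × R3 | dist p.1 p.2 ≤ r} :=
      (isClosed_le (by fun_prop) (by fun_prop)).measurableSet
    have := (hW.comp_fst (ν := (volume : Measure R3))).indicator hs
    refine this.congr (Eventually.of_forall fun p => ?_)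
    simp [Set.indicator, Metric.mem_closedBall]
  have main : B * ∫⁻ y in (Metric.closedBall x r)ᶜ,
      W y * ENNReal.ofReal ((‖x - y‖ ^ 4)⁻¹) ≤ ENNReal.ofReal K * (J * N) := by
    rw [← lintegral_const_mul' _ _ hBt]
    calc _ ≤ ∫⁻ y in (Metric.closedBall x r)ᶜ, ∫⁻ w, ENNReal.ofReal K *
          (ENNReal.ofReal ((1 + ‖x - w‖) ^ (-4 : ℝ)) *
            (Metric.closedBall w r).indicator W y) :=
          setLIntegral_mono' Metric.isClosed_closedBall.measurableSet.compl hpt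
      _ ≤ ∫⁻ y, ∫⁻ w, ENNReal.ofReal K *
          (ENNReal.ofReal ((1 + ‖x - w‖) ^ (-4 : ℝ)) *
            (Metric.closedBall w r).indicator W y) := setLIntegral_le_lintegral _ _
      _ = ∫⁻ w, ∫⁻ y, ENNReal.ofReal K *
          (ENNReal.ofReal ((1 + ‖x - w‖) ^ (-4 : ℝ)) *
            (Metric.closedBall w r).indicator W y) := lintegral_lintegral_swap hmeas
      _ ≤ ∫⁻ w, ENNReal.ofReal K * (ENNReal.ofReal ((1 + ‖x - w‖) ^ (-4 : ℝ)) * N) := by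
          refine lintegral_mono fun w => ?_
          rw [lintegral_const_mul' _ _ (by simp), lintegral_const_mul' _ _ (by simp),
            lintegral_indicator Metric.isClosed_closedBall.measurableSet]
          gcongr
          exact h w
      _ = _ := by
          rw [lintegral_const_mul' _ _ (by simp), lintegral_mul_const' _ _ hN, hJx]
  rwa [mul_comm B⁻¹, ← div_eq_mul_inv, ENNReal.le_div_iff_mul_le (Or.inl hB0) (Or.inl hBt),
    mul_comm]

theorem IsKatoClass.exists_lintegral_green_le {V : R3 → ℝ} (hV : IsKatoClass V) {ε : ℝ≥0∞}
    (hε : 0 < ε) (hεt : ε ≠ ∞) :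
    ∃ lam : ℝ, 0 < lam ∧ ∀ x, ∫⁻ y, ‖V y‖ₑ * green lam (x - y) ≤ ε := by
  have hε2 : 0 < ε / 2 := ENNReal.half_pos hε.ne'
  have hδ : 0 < ε / 2 / 8 := ENNReal.div_pos hε2.ne' (by simp)
  -- The radius is fixed first, with 8 from `green_le_div` making the near part at most ε/2; λ is
  -- chosen afterwards, since the far bound M depends on r.
  obtain ⟨r, hr, hr0⟩ := ((hV.2.eventually (gt_mem_nhds hδ)).and self_mem_nhdsWithin).exists
  have hr0 : 0 < r := hr0
  have hsup (x : R3) : ∫⁻ y in Metric.closedBall x r, ‖V y‖ₑ / ‖x - y‖ₑ ≤ ε / 2 / 8 :=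
    (le_iSup (fun x : R3 => ∫⁻ y in Metric.closedBall x r, ‖V y‖ₑ / ‖x - y‖ₑ) x).trans hr.le
  have hδt : ε / 2 / 8 ≠ ∞ := ENNReal.div_ne_top (ENNReal.div_ne_top hεt (by simp)) (by simp)
  obtain ⟨M, hM, hfar⟩ := exists_far_bound hV.1.enorm hr0
    (N := ENNReal.ofReal r * (ε / 2 / 8)) (ENNReal.mul_ne_top (by simp) hδt)
    (fun x => (setLIntegral_closedBall_le _ hr0 x).trans (by gcongr; exact hsup x))
  have hlim : Tendsto (fun lam => ENNReal.ofReal (greenDecay lam) * M) atTop (𝓝 0) := by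
    have := ENNReal.Tendsto.mul_const (b := M) (ENNReal.tendsto_ofReal tendsto_greenDecay)
      (Or.inr hM)
    simpa using this
  obtain ⟨lam, hlam, hl0⟩ := ((hlim.eventually (gt_mem_nhds hε2)).and
    (eventually_gt_atTop (0 : ℝ))).exists
  refine ⟨lam, hl0, fun x => ?_⟩
  rw [← lintegral_add_compl _ (Metric.isClosed_closedBall (x := x) (ε := r)).measurableSet,
    ← ENNReal.add_halves ε]
  refine add_le_add ?_ ?_
  · calc _ ≤ ∫⁻ y in Metric.closedBall x r, 8 * (‖V y‖ₑ / ‖x - y‖ₑ) := by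
          refine lintegral_mono fun y => ?_
          refine (mul_le_mul_right (green_le_div hl0.le (x - y)) _).trans (le_of_eq ?_)
          simp only [div_eq_mul_inv]
          ring
      _ ≤ 8 * (ε / 2 / 8) := by
          rw [lintegral_const_mul' _ _ (by simp)]
          gcongr
          exact hsup x
      _ = ε / 2 := ENNReal.mul_div_cancel (by simp) (by simp)
  · calc _ ≤ ∫⁻ y in (Metric.closedBall x r)ᶜ, ENNReal.ofReal (greenDecay lam) *
          (‖V y‖ₑ * ENNReal.ofReal ((‖x - y‖ ^ 4)⁻¹)) := by
          refine setLIntegral_mono' Metric.isClosed_closedBall.measurableSet.compl fun y hy => ?_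
          have hxy : x - y ≠ 0 := by
            intro h0
            rw [sub_eq_zero] at h0
            subst h0
            simp [hr0.le] at hy
          refine (mul_le_mul_right (green_le_decay hl0 hxy) _).trans (le_of_eq ?_)
          ring
      _ ≤ ENNReal.ofReal (greenDecay lam) * M := by
          rw [lintegral_const_mul' _ _ (by simp)]
          gcongr
          exact hfar x
      _ ≤ _ := hlam.le

end Kato

/-! ### The relative form bound with arbitrarily small constant -/

section FormBound

theorem two_mul_le_sq_add_sq (a b : ℝ≥0∞) : 2 * a * b ≤ a ^ 2 + b ^ 2 := by
  wlog h : a ≤ b generalizing a b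
  · rw [mul_right_comm, add_comm]
    exact this b a (le_of_not_ge h)
  obtain ⟨c, rfl⟩ := exists_add_of_le h
  calc 2 * a * (a + c) ≤ 2 * a * (a + c) + c ^ 2 := le_self_add
    _ = a ^ 2 + (a + c) ^ 2 := by ring

/-- Schur test: 2b(x)b(y) ≤ b(x)² + b(y)², and the two resulting terms agree by the symmetry of G.
-/
theorem lintegral_lintegral_symm_mul_le {a b : R3 → ℝ≥0∞} (ha : AEMeasurable a volume)
    (hb : AEMeasurable b volume) {G : R3 → ℝ≥0∞} (hG : Measurable G) (hGs : ∀ z, G (-z) = G z)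
    {η : ℝ≥0∞} (h : ∀ x, ∫⁻ y, a y * G (x - y) ≤ η) :
    ∫⁻ x, ∫⁻ y, (a x * b x) * (a y * b y) * G (x - y) ≤ η * ∫⁻ x, a x * b x ^ 2 := by
  have hab : AEMeasurable (fun x => a x * b x ^ 2) volume := ha.mul (hb.pow_const 2)
  have hGm : Measurable fun p : R3 × R3 => G (p.1 - p.2) := by fun_prop
  have ha2 (x : R3) : AEMeasurable (fun y => a y * G (x - y)) volume :=
    ha.mul (by fun_prop : Measurable fun y => G (x - y)).aemeasurable
  have h1 : ∫⁻ x, ∫⁻ y, (a x * b x ^ 2) * (a y * G (x - y)) ≤ η * ∫⁻ x, a x * b x ^ 2 := by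
    rw [← lintegral_const_mul'' _ hab]
    refine lintegral_mono fun x => ?_
    rw [lintegral_const_mul'' _ (ha2 x), mul_comm]
    gcongr
    exact h x
  have h2 : ∫⁻ x, ∫⁻ y, (a y * b y ^ 2) * (a x * G (x - y)) ≤ η * ∫⁻ x, a x * b x ^ 2 := by
    rw [lintegral_lintegral_swap]
    · refine le_trans (le_of_eq ?_) h1
      congr 1; ext y; congr 1; ext x
      rw [← hGs, neg_sub]
    · exact hab.comp_snd.mul (ha.comp_fst.mul hGm.aemeasurable)
  have h3 : 2 * ∫⁻ x, ∫⁻ y, (a x * b x) * (a y * b y) * G (x - y) ≤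
      2 * (η * ∫⁻ x, a x * b x ^ 2) := by
    calc _ = ∫⁻ x, ∫⁻ y, 2 * ((a x * b x) * (a y * b y) * G (x - y)) := by
          simp_rw [lintegral_const_mul' 2 _ (by simp : (2 : ℝ≥0∞) ≠ ∞)]
      _ ≤ ∫⁻ x, ∫⁻ y, ((a x * b x ^ 2) * (a y * G (x - y)) +
            (a y * b y ^ 2) * (a x * G (x - y))) := by
          gcongr with x y
          have := two_mul_le_sq_add_sq (b x) (b y)
          calc _ = a x * a y * G (x - y) * (2 * b x * b y) := by ring
            _ ≤ a x * a y * G (x - y) * (b x ^ 2 + b y ^ 2) := by gcongr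
            _ = _ := by ring
      _ = ∫⁻ x, ((∫⁻ y, (a x * b x ^ 2) * (a y * G (x - y))) +
            ∫⁻ y, (a y * b y ^ 2) * (a x * G (x - y))) := by
          congr 1; ext x
          rw [lintegral_add_left' ((ha2 x).const_mul _)]
      _ = (∫⁻ x, ∫⁻ y, (a x * b x ^ 2) * (a y * G (x - y))) +
            ∫⁻ x, ∫⁻ y, (a y * b y ^ 2) * (a x * G (x - y)) := by
          rw [lintegral_add_left']
          exact AEMeasurable.lintegral_prod_right' (f := fun p : R3 × R3 =>
            (a p.1 * b p.1 ^ 2) * (a p.2 * G (p.1 - p.2)))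
            (hab.comp_fst.mul (ha.comp_snd.mul hGm.aemeasurable))
      _ ≤ _ := by
          rw [two_mul]
          gcongr
  exact (ENNReal.mul_le_mul_iff_right (by simp) (by simp)).mp h3

theorem lintegral_form_le_of_measurable {V : R3 → ℝ} (hV : Measurable V) {lam : ℝ} (hl : 0 < lam)
    {η : ℝ≥0∞} (h : ∀ x, ∫⁻ y, ‖V y‖ₑ * green lam (x - y) ≤ η) (u : H1) :
    ∫⁻ x, ‖V x‖ₑ * ‖(u : L2) x‖ₑ ^ 2 ≤
      ENNReal.ofReal (lam * ‖(u : L2)‖ ^ 2 + gradNormSq u) * η := by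
  have hu : Measurable (fun x => (u : L2) x) := (Lp.stronglyMeasurable (u : L2)).measurable
  -- On these sets V, u and x are bounded, so the truncated h lies in L¹ ∩ L² and A is finite. The
  -- bound is independent of n, and the sets exhaust the space.
  set E : ℕ → Set R3 := fun n => {x | |V x| ≤ n ∧ ‖(u : L2) x‖ ≤ n ∧ ‖x‖ ≤ n} with hE
  have hEm (n : ℕ) : MeasurableSet (E n) := by
    have hVa : Measurable fun x => |V x| := hV.norm
    exact (measurableSet_le hVa measurable_const).inter
      ((measurableSet_le hu.norm measurable_const).inter
      (measurableSet_le measurable_norm measurable_const))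
  have hmono : Monotone E := by
    intro m n hmn x hx
    have : (m : ℝ) ≤ n := by exact_mod_cast hmn
    exact ⟨hx.1.trans this, hx.2.1.trans this, hx.2.2.trans this⟩
  have hcover : ⋃ n, E n = Set.univ := by
    refine Set.eq_univ_of_forall fun x => Set.mem_iUnion.mpr ?_
    obtain ⟨n, hn⟩ := exists_nat_ge (max |V x| (max ‖(u : L2) x‖ ‖x‖))
    exact ⟨n, by simpa [hE] using hn⟩
  rw [← setLIntegral_univ, ← hcover, setLIntegral_iUnion_of_directed _ hmono.directed_le]
  refine iSup_le fun n => ?_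
  have hfin : volume (E n) < ∞ := by
    refine (measure_mono (t := Metric.closedBall 0 n) fun x hx => ?_).trans_lt
      measure_closedBall_lt_top
    simpa using hx.2.2
  set f : R3 → ℂ := (E n).indicator fun x => ((|V x| : ℝ) : ℂ) * (u : L2) x with hf
  have hfm : Measurable f := by
    refine Measurable.indicator ?_ (hEm n)
    fun_prop
  have hfp (p : ℝ≥0∞) : MemLp f p volume := by
    rw [hf, memLp_indicator_iff_restrict (hEm n)]
    have : IsFiniteMeasure (volume.restrict (E n)) := ⟨by simpa using hfin⟩
    refine MemLp.of_bound (Measurable.aestronglyMeasurable (by fun_prop)) (n * n) ?_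
    filter_upwards [ae_restrict_mem (hEm n)] with x hx
    rw [norm_mul, Complex.norm_real, Real.norm_eq_abs, abs_abs]
    exact mul_le_mul hx.1 hx.2.1 (by positivity) (by positivity)
  have hA : ∫⁻ x in E n, ‖V x‖ₑ * ‖(u : L2) x‖ₑ ^ 2 = ‖∫ x, conj (f x) * (u : L2) x‖ₑ := by
    have e (x : R3) : conj (f x) * (u : L2) x =
        (((E n).indicator (fun x => |V x| * ‖(u : L2) x‖ ^ 2) x : ℝ) : ℂ) := by
      by_cases hx : x ∈ E n
      · simp only [hf, Set.indicator_of_mem hx, map_mul, Complex.conj_ofReal, mul_assoc,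
          Complex.conj_mul']
        push_cast
        ring
      · simp [hf, Set.indicator_of_notMem hx]
    have hint : IntegrableOn (fun x => |V x| * ‖(u : L2) x‖ ^ 2) (E n) := by
      have : IsFiniteMeasure (volume.restrict (E n)) := ⟨by simpa using hfin⟩
      refine Integrable.of_bound (C := n * n ^ 2) (Measurable.aestronglyMeasurable ?_) ?_
      · exact hV.norm.mul (hu.norm.pow_const 2)
      filter_upwards [ae_restrict_mem (hEm n)] with x hx
      rw [norm_mul, Real.norm_eq_abs, abs_abs, norm_pow, norm_norm]
      exact mul_le_mul hx.1 (pow_le_pow_left₀ (by positivity) hx.2.1 2) (by positivity)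
        (by positivity)
    simp_rw [e]
    rw [integral_complex_ofReal, integral_indicator (hEm n), ← ofReal_norm, Complex.norm_real,
      Real.norm_of_nonneg (integral_nonneg fun x => by positivity),
      ofReal_integral_eq_lintegral_ofReal hint (Eventually.of_forall fun x => by positivity)]
    congr 1; ext x
    rw [ENNReal.ofReal_mul (by positivity), ENNReal.ofReal_pow (by positivity), ofReal_norm,
      ← Real.norm_eq_abs, ofReal_norm]
  set A := ∫⁻ x in E n, ‖V x‖ₑ * ‖(u : L2) x‖ₑ ^ 2 with hAdef
  have hAt : A ≠ ∞ := by rw [hA]; exact enorm_ne_top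
  have key := enorm_integral_conj_mul_sq_le (memLp_one_iff_integrable.mp (hfp 1)) (hfp 2) hl u
  rw [← hA] at key
  have hsym := lintegral_lintegral_symm_mul_le (a := fun x => ‖V x‖ₑ)
    (b := (E n).indicator fun x => ‖(u : L2) x‖ₑ) hV.enorm.aemeasurable
    (hu.enorm.indicator (hEm n)).aemeasurable (measurable_green lam) (green_neg lam) h
  have e1 (x : R3) : ‖V x‖ₑ * (E n).indicator (fun x => ‖(u : L2) x‖ₑ) x = ‖f x‖ₑ := by
    by_cases hx : x ∈ E n
    · simp [hf, Set.indicator_of_mem hx, ← ofReal_norm]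
    · simp [hf, Set.indicator_of_notMem hx]
  have e2 : ∫⁻ x, ‖V x‖ₑ * (E n).indicator (fun x => ‖(u : L2) x‖ₑ) x ^ 2 = A := by
    rw [hAdef, ← lintegral_indicator (hEm n)]
    congr 1; ext x
    by_cases hx : x ∈ E n
    · simp [Set.indicator_of_mem hx]
    · simp [Set.indicator_of_notMem hx]
  simp_rw [e1] at hsym
  rw [e2] at hsym
  rcases eq_or_ne A 0 with h0 | h0
  · rw [h0]; exact zero_le
  -- A occurs on both sides; being finite and nonzero, it can be cancelled.
  have : A * A ≤ ENNReal.ofReal (lam * ‖(u : L2)‖ ^ 2 + gradNormSq u) * η * A := by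
    rw [← sq, mul_assoc]
    exact key.trans (mul_le_mul_right hsym _)
  exact (ENNReal.mul_le_mul_iff_left h0 hAt).mp this

theorem IsKatoClass.exists_form_bound {V : R3 → ℝ} (hV : IsKatoClass V) {ε : ℝ} (hε : 0 < ε) :
    ∃ C : ℝ, 0 ≤ C ∧ ∀ u : H1, ∫⁻ x, ‖V x‖ₑ * ‖(u : L2) x‖ₑ ^ 2 ≤
      ENNReal.ofReal (ε * gradNormSq u + C * ‖(u : L2)‖ ^ 2) := by
  obtain ⟨lam, hl, h⟩ := hV.exists_lintegral_green_le (ε := ENNReal.ofReal ε)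
    (by simpa using hε) (by simp)
  refine ⟨lam * ε, by positivity, fun u => ?_⟩
  have hae := hV.1.ae_eq_mk
  have e (F : R3 → ℝ≥0∞) : ∫⁻ x, ‖hV.1.mk V x‖ₑ * F x = ∫⁻ x, ‖V x‖ₑ * F x := by
    apply lintegral_congr_ae
    filter_upwards [hae] with x hx
    rw [hx]
  rw [← e]
  refine (lintegral_form_le_of_measurable hV.1.measurable_mk hl (η := ENNReal.ofReal ε)
    (fun x => by rw [e]; exact h x) u).trans (le_of_eq ?_)
  rw [← ENNReal.ofReal_mul' hε.le]
  congr 1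
  ring

end FormBound

/-! ### Calculus of weak derivatives in H¹ -/

section Sobolev

theorem partialDeriv_eq_of_lineDerivOp_eq (i : Fin 3) (u : H1) (g : L2)
    (h : ∂_{(EuclideanSpace.single i (1 : ℝ) : R3)} ((u : L2) : 𝓢'(R3, ℂ)) = (g : 𝓢'(R3, ℂ))) :
    partialDeriv i u = g :=
  toTemperedDistribution_injective ((partialDeriv_spec i u).symm.trans h)

theorem partialDeriv_add (i : Fin 3) (u v : H1) :
    partialDeriv i (u + v) = partialDeriv i u + partialDeriv i v := by
  apply partialDeriv_eq_of_lineDerivOp_eq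
  rw [← Lp.toTemperedDistributionCLM_apply, ← Lp.toTemperedDistributionCLM_apply, map_add,
    Submodule.coe_add, map_add]
  simp only [Lp.toTemperedDistributionCLM_apply]
  rw [← partialDeriv_spec, ← partialDeriv_spec, LineDeriv.lineDerivOp_add]

theorem partialDeriv_smul (i : Fin 3) (c : ℂ) (u : H1) :
    partialDeriv i (c • u) = c • partialDeriv i u := by
  apply partialDeriv_eq_of_lineDerivOp_eq
  rw [← Lp.toTemperedDistributionCLM_apply, ← Lp.toTemperedDistributionCLM_apply, map_smul,
    Submodule.coe_smul, map_smul]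
  simp only [Lp.toTemperedDistributionCLM_apply]
  rw [← partialDeriv_spec, LineDeriv.lineDerivOp_smul]

theorem partialDeriv_sub (i : Fin 3) (u v : H1) :
    partialDeriv i (u - v) = partialDeriv i u - partialDeriv i v := by
  rw [eq_sub_iff_add_eq, ← partialDeriv_add, sub_add_cancel]

theorem partialDeriv_schwartzToH1 (i : Fin 3) (f : 𝓢(R3, ℂ)) :
    partialDeriv i (schwartzToH1 f) =
      (∂_{(EuclideanSpace.single i (1 : ℝ) : R3)} f).toLp 2 volume := by
  apply partialDeriv_eq_of_lineDerivOp_eq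
  rw [schwartzToH1, Lp.toTemperedDistribution_toLp_eq, Lp.toTemperedDistribution_toLp_eq,
    TemperedDistribution.lineDerivOp_toTemperedDistributionCLM_eq]

theorem inner_eq_integral (f g : L2) : inner ℂ f g = ∫ x, g x * conj (f x) := by
  rw [L2.inner_def]
  rfl

/-- Integration by parts, seen on the Fourier side: the multiplier 2πiξᵢ is purely imaginary. -/
theorem inner_partialDeriv_left (i : Fin 3) (u v : H1) :
    inner ℂ (partialDeriv i u) (v : L2) = -inner ℂ (u : L2) (partialDeriv i v) := by
  rw [← Lp.inner_fourier_eq, ← Lp.inner_fourier_eq (u : L2), inner_eq_integral,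
    inner_eq_integral, ← integral_neg]
  apply integral_congr_ae
  filter_upwards [fourier_partialDeriv_ae i u, fourier_partialDeriv_ae i v] with ξ h1 h2
  rw [h1, h2]
  simp only [map_mul, Complex.conj_ofReal, Complex.conj_I, map_ofNat]
  ring

theorem dense_H1 : Dense (H1 : Set L2) := by
  refine (SchwartzMap.denseRange_toLpCLM (E := R3) (F := ℂ) (μ := volume) (p := 2)
    ENNReal.ofNat_ne_top).mono ?_
  rintro _ ⟨f, rfl⟩
  exact toLp_mem_H1 f

theorem gradNormSq_nonneg (u : H1) : 0 ≤ gradNormSq u :=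
  Finset.sum_nonneg fun _ _ => by positivity

theorem norm_partialDeriv_sq_le (i : Fin 3) (u : H1) : ‖partialDeriv i u‖ ^ 2 ≤ gradNormSq u :=
  Finset.single_le_sum (f := fun i => ‖partialDeriv i u‖ ^ 2) (fun _ _ => by positivity)
    (Finset.mem_univ i)

/-- The Bessel symbol is 1 + |ξ|² while −Δ has symbol (2π)²|ξ|², hence the factor (2π)⁻². -/
theorem besselPotential_two_eq (T : 𝓢'(R3, ℂ)) :
    TemperedDistribution.besselPotential R3 ℂ 2 T = T - (((2 * Real.pi) ^ 2)⁻¹ : ℝ) • Δ T := by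
  rw [TemperedDistribution.laplacian_eq_fourierMultiplierCLM, smul_smul,
    TemperedDistribution.besselPotential]
  have h1 : (fun x : R3 => (((1 + ‖x‖ ^ 2) ^ ((2 : ℝ) / 2) : ℝ) : ℂ)) =
      (fun _ => (1 : ℂ)) + fun x => ((‖x‖ ^ 2 : ℝ) : ℂ) := by
    ext x; simp
  have hc : ((2 * Real.pi) ^ 2)⁻¹ * -(2 * Real.pi) ^ 2 = -1 := by
    have := Real.pi_ne_zero
    field_simp
  rw [h1, hc, neg_one_smul, sub_neg_eq_add]
  have h2 := TemperedDistribution.smulLeftCLM_add (F := ℂ) (g₁ := fun _ : R3 => (1 : ℂ))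
    (g₂ := fun x : R3 => ((‖x‖ ^ 2 : ℝ) : ℂ)) (by fun_prop) (by fun_prop)
  simp only [TemperedDistribution.fourierMultiplierCLM_apply, h2]
  simp [FourierTransform.fourierInv_add]

/-- The Bessel potential of order 2 lowers the Sobolev order by 2, so it is enough that u − (2π)⁻²Δu
lies in H⁻¹. This holds because Δu = ∑ ∂ᵢgᵢ with gᵢ ∈ L². -/
theorem mem_H1_of_lineDerivOp {u : L2} {g : Fin 3 → L2}
    (h : ∀ i, ∂_{(EuclideanSpace.single i (1 : ℝ) : R3)} (u : 𝓢'(R3, ℂ)) = (g i : 𝓢'(R3, ℂ))) :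
    u ∈ H1 := by
  have hL2 (f : L2) : TemperedDistribution.MemSobolev 0 2 (f : 𝓢'(R3, ℂ)) :=
    TemperedDistribution.memSobolev_zero_iff.mpr ⟨f, rfl⟩
  rw [mem_H1_iff, show (1 : ℝ) = 2 + -1 by norm_num,
    ← TemperedDistribution.memSobolev_besselPotential_iff, besselPotential_two_eq,
    TemperedDistribution.laplacian_eq_sum (EuclideanSpace.basisFun (Fin 3) ℝ),
    Fin.sum_univ_three]
  simp only [EuclideanSpace.basisFun_apply, h]
  have hd (i : Fin 3) : TemperedDistribution.MemSobolev (-1) 2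
      (∂_{(EuclideanSpace.single i (1 : ℝ) : R3)} (g i : 𝓢'(R3, ℂ))) := by
    simpa using (hL2 (g i)).lineDerivOp (m := (EuclideanSpace.single i (1 : ℝ) : R3))
  have hr (c : ℝ) (T : 𝓢'(R3, ℂ)) : c • T = (c : ℂ) • T := by
    ext φ
    simp
  rw [hr]
  exact ((hL2 u).mono (by norm_num)).sub ((((hd 0).add (hd 1)).add (hd 2)).smul _)

/-- Differentiation is continuous on tempered distributions and L² embeds continuously in them, so
the weak derivative is a closed operator. -/
theorem lineDerivOp_eq_of_tendsto {s : ℕ → H1} {u g : L2} (i : Fin 3)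
    (hu : Tendsto (fun n => (s n : L2)) atTop (𝓝 u))
    (hg : Tendsto (fun n => partialDeriv i (s n)) atTop (𝓝 g)) :
    ∂_{(EuclideanSpace.single i (1 : ℝ) : R3)} (u : 𝓢'(R3, ℂ)) = (g : 𝓢'(R3, ℂ)) := by
  have hT := (Lp.toTemperedDistributionCLM ℂ (volume : Measure R3) 2).continuous
  have hD := (LineDeriv.lineDerivOpCLM ℂ 𝓢'(R3, ℂ)
    (EuclideanSpace.single i (1 : ℝ) : R3)).continuous
  have h1 := ((hD.comp hT).tendsto u).comp hu
  have h2 := (hT.tendsto g).comp hg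
  refine tendsto_nhds_unique h1 (h2.congr fun n => ?_)
  exact (partialDeriv_spec i (s n)).symm

end Sobolev

/-! ### Bounds, closedness and the operator formula for the form -/

section Form

variable {V : R3 → ℝ}

theorem IsKatoClass.lintegral_potential_lt_top (hV : IsKatoClass V) (u : H1) :
    ∫⁻ x, ‖V x‖ₑ * ‖(u : L2) x‖ₑ ^ 2 < ∞ := by
  obtain ⟨C, -, hC⟩ := hV.exists_form_bound one_pos
  exact (hC u).trans_lt ENNReal.ofReal_lt_top

theorem IsKatoClass.integrable_potential (hV : IsKatoClass V) (u v : H1) :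
    Integrable (fun x => (V x : ℂ) * ((u : L2) x * conj ((v : L2) x))) := by
  have hVm : AEStronglyMeasurable (fun x => (V x : ℂ)) volume :=
    Complex.continuous_ofReal.comp_aestronglyMeasurable hV.1.aestronglyMeasurable
  refine ⟨hVm.mul ((Lp.aestronglyMeasurable _).mul
    (Complex.continuous_conj.comp_aestronglyMeasurable (Lp.aestronglyMeasurable _))), ?_⟩
  have hm : AEMeasurable (fun x => ‖V x‖ₑ * ‖(u : L2) x‖ₑ ^ 2) volume :=
    hV.1.enorm.mul ((Lp.aestronglyMeasurable _).enorm.pow_const 2)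
  calc ∫⁻ x, ‖(V x : ℂ) * ((u : L2) x * conj ((v : L2) x))‖ₑ
      ≤ ∫⁻ x, (‖V x‖ₑ * ‖(u : L2) x‖ₑ ^ 2 + ‖V x‖ₑ * ‖(v : L2) x‖ₑ ^ 2) := by
        refine lintegral_mono fun x => ?_
        have hc : ‖conj ((v : L2) x)‖ₑ = ‖(v : L2) x‖ₑ := by simp
        have hr : ‖(V x : ℂ)‖ₑ = ‖V x‖ₑ := by simp [← ofReal_norm]
        rw [enorm_mul, enorm_mul, hc, hr, ← mul_add]
        gcongr
        refine le_trans ?_ (two_mul_le_sq_add_sq _ _)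
        rw [mul_assoc, two_mul]
        exact le_self_add
    _ < ∞ := by
        rw [lintegral_add_left' hm]
        exact ENNReal.add_lt_top.mpr
          ⟨hV.lintegral_potential_lt_top u, hV.lintegral_potential_lt_top v⟩

theorem q_eq_inner (u v : H1) : q V u v =
    (∑ i : Fin 3, inner ℂ (partialDeriv i v) (partialDeriv i u)) +
      ∫ x, (V x : ℂ) * ((u : L2) x * conj ((v : L2) x)) := by
  simp only [q, inner_eq_integral]

theorem q_self (u : H1) :
    q V u u = ((gradNormSq u + ∫ x, V x * ‖(u : L2) x‖ ^ 2 : ℝ) : ℂ) := by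
  rw [q_eq_inner, gradNormSq, Complex.ofReal_add, ← integral_complex_ofReal]
  simp only [inner_self_eq_norm_sq_to_K, Complex.mul_conj, Complex.normSq_eq_norm_sq]
  push_cast
  rfl

theorem IsKatoClass.exists_abs_potential_le (hV : IsKatoClass V) {ε : ℝ} (hε : 0 < ε) :
    ∃ C : ℝ, 0 ≤ C ∧ ∀ u : H1, |∫ x, V x * ‖(u : L2) x‖ ^ 2| ≤
      ε * gradNormSq u + C * ‖(u : L2)‖ ^ 2 := by
  obtain ⟨C, hC0, hC⟩ := hV.exists_form_bound hε
  refine ⟨C, hC0, fun u => ?_⟩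
  have h0 : 0 ≤ ε * gradNormSq u + C * ‖(u : L2)‖ ^ 2 := by
    have := gradNormSq_nonneg u
    positivity
  rw [← Real.norm_eq_abs, ← ENNReal.ofReal_le_ofReal_iff h0, ofReal_norm]
  refine (enorm_integral_le_lintegral_enorm _).trans (le_trans (le_of_eq ?_) (hC u))
  simp [enorm_mul, enorm_pow]

theorem IsKatoClass.exists_q_bounds (hV : IsKatoClass V) :
    ∃ a₀ : ℝ, 1 < a₀ ∧ ∀ a : ℝ, a₀ ≤ a → ∀ u : H1,
      (q V u u).im = 0 ∧
      (1 / 2) * gradNormSq u - a * ‖(u : L2)‖ ^ 2 ≤ (q V u u).re ∧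
      (q V u u).re ≤ (3 / 2) * gradNormSq u + a * ‖(u : L2)‖ ^ 2 := by
  obtain ⟨C, hC0, hC⟩ := hV.exists_abs_potential_le (ε := 1 / 2) (by norm_num)
  -- Only a ≥ C is needed for the bounds; adding 2 secures 1 < a₀ even when C = 0.
  refine ⟨C + 2, by linarith, fun a ha u => ?_⟩
  rw [q_self, Complex.ofReal_re, Complex.ofReal_im]
  have h1 := abs_le.mp (hC u)
  have h2 : C * ‖(u : L2)‖ ^ 2 ≤ a * ‖(u : L2)‖ ^ 2 := by gcongr; linarith
  exact ⟨rfl, by linarith [h1.1], by linarith [h1.2]⟩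

theorem IsKatoClass.q_add_left (hV : IsKatoClass V) (u v w : H1) :
    q V (u + v) w = q V u w + q V v w := by
  have e : ∫ x, (V x : ℂ) * (((u + v : H1) : L2) x * conj ((w : L2) x)) =
      (∫ x, (V x : ℂ) * ((u : L2) x * conj ((w : L2) x))) +
        ∫ x, (V x : ℂ) * ((v : L2) x * conj ((w : L2) x)) := by
    rw [← integral_add (hV.integrable_potential u w) (hV.integrable_potential v w)]
    apply integral_congr_ae
    filter_upwards [Lp.coeFn_add (u : L2) (v : L2)] with x hx
    rw [Submodule.coe_add, hx, Pi.add_apply]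
    ring
  simp only [q_eq_inner, partialDeriv_add, inner_add_right, Finset.sum_add_distrib, e]
  ring

theorem q_smul_left (c : ℂ) (u v : H1) : q V (c • u) v = c * q V u v := by
  have e : ∫ x, (V x : ℂ) * (((c • u : H1) : L2) x * conj ((v : L2) x)) =
      c * ∫ x, (V x : ℂ) * ((u : L2) x * conj ((v : L2) x)) := by
    rw [← integral_const_mul]
    apply integral_congr_ae
    filter_upwards [Lp.coeFn_smul c (u : L2)] with x hx
    rw [Submodule.coe_smul, hx, Pi.smul_apply, smul_eq_mul]
    ring
  simp only [q_eq_inner, partialDeriv_smul, inner_smul_right, ← Finset.mul_sum, e]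
  ring

theorem q_conj_symm (u v : H1) : conj (q V u v) = q V v u := by
  rw [q_eq_inner, q_eq_inner, map_add, map_sum, ← integral_conj]
  simp only [inner_conj_symm, map_mul, Complex.conj_ofReal, Complex.conj_conj]
  congr 2
  ext x
  ring

theorem IsKatoClass.isLowerSemiboundedForm (hV : IsKatoClass V) :
    IsLowerSemiboundedForm H1 (q V) where
  dense := dense_H1
  add_left := hV.q_add_left
  smul_left := q_smul_left
  conj_symm := q_conj_symm
  lower_bound := by
    obtain ⟨a, -, ha⟩ := hV.exists_q_bounds
    refine ⟨a, fun u => ?_⟩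
    have h := (ha a le_rfl u).2.1
    have := gradNormSq_nonneg u
    linarith

theorem IsKatoClass.isClosedForm (hV : IsKatoClass V) : IsClosedForm H1 (q V) := by
  intro s u hs hQ
  obtain ⟨a, -, ha⟩ := hV.exists_q_bounds
  have hgrad : Tendsto (fun p : ℕ × ℕ => gradNormSq (s p.1 - s p.2)) atTop (𝓝 0) := by
    have h1 : Tendsto (fun p : ℕ × ℕ => ‖((s p.1 - s p.2 : H1) : L2)‖ ^ 2) atTop (𝓝 0) := by
      have := (cauchySeq_iff_tendsto_dist_atTop_0.mp hs.cauchySeq).pow 2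
      simpa [dist_eq_norm] using this
    have h2 := (Complex.continuous_re.tendsto _).comp hQ
    -- The lower bound rearranges to ‖∇w‖² ≤ 2q(w, w) + 2a‖w‖² for w = sₙ − sₘ.
    have h3 := (h2.const_mul 2).add (h1.const_mul (2 * a))
    simp only [Complex.zero_re, mul_zero, add_zero] at h3
    refine squeeze_zero (fun p => gradNormSq_nonneg _) (fun p => ?_) h3
    have := (ha a le_rfl (s p.1 - s p.2)).2.1
    simp only [Function.comp_apply]
    linarith
  have hcauchy (i : Fin 3) : CauchySeq fun n => partialDeriv i (s n) := by
    rw [cauchySeq_iff_tendsto_dist_atTop_0]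
    have h1 := (Real.continuous_sqrt.tendsto 0).comp hgrad
    rw [Real.sqrt_zero] at h1
    refine squeeze_zero (fun p => dist_nonneg) (fun p => ?_) h1
    rw [dist_eq_norm, ← partialDeriv_sub]
    exact Real.le_sqrt_of_sq_le (norm_partialDeriv_sq_le i _)
  choose g hg using fun i => cauchySeq_tendsto_of_complete (hcauchy i)
  have hdist (i : Fin 3) := lineDerivOp_eq_of_tendsto i hs (hg i)
  have hu : u ∈ H1 := mem_H1_of_lineDerivOp hdist
  refine ⟨hu, ?_⟩
  have hg' : Tendsto (fun n => gradNormSq (s n - ⟨u, hu⟩)) atTop (𝓝 0) := by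
    unfold gradNormSq
    rw [← Finset.sum_const_zero (s := (Finset.univ : Finset (Fin 3)))]
    refine tendsto_finsetSum _ fun i _ => ?_
    simp only [partialDeriv_sub, partialDeriv_eq_of_lineDerivOp_eq i ⟨u, hu⟩ (g i) (hdist i)]
    simpa using (tendsto_iff_norm_sub_tendsto_zero.mp (hg i)).pow 2
  have hn : Tendsto (fun n => ‖((s n - ⟨u, hu⟩ : H1) : L2)‖ ^ 2) atTop (𝓝 0) := by
    simpa using (tendsto_iff_norm_sub_tendsto_zero.mp hs).pow 2
  have hb := (hg'.const_mul (3 / 2)).add (hn.const_mul a)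
  simp only [mul_zero, add_zero] at hb
  refine squeeze_zero_norm (fun n => ?_) hb
  obtain ⟨him, hlo, hup⟩ := ha a le_rfl (s n - ⟨u, hu⟩)
  have hre : q V (s n - ⟨u, hu⟩) (s n - ⟨u, hu⟩) =
      ((q V (s n - ⟨u, hu⟩) (s n - ⟨u, hu⟩)).re : ℂ) := Complex.ext rfl (by simpa using him)
  rw [hre, Complex.norm_real, Real.norm_eq_abs, abs_le]
  have := gradNormSq_nonneg (s n - ⟨u, hu⟩)
  exact ⟨by linarith, hup⟩

theorem inner_toLp_laplacian (u : H1) (f : 𝓢(R3, ℂ)) :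
    inner ℂ ((Δ f).toLp 2 volume : L2) (u : L2) =
      -∑ i : Fin 3, inner ℂ (partialDeriv i (schwartzToH1 f)) (partialDeriv i u) := by
  have e : ((Δ f).toLp 2 volume : L2) = ∑ i : Fin 3, partialDeriv i
      (schwartzToH1 (∂_{(EuclideanSpace.single i (1 : ℝ) : R3)} f)) := by
    simp only [partialDeriv_schwartzToH1]
    rw [SchwartzMap.laplacian_eq_sum (EuclideanSpace.basisFun (Fin 3) ℝ)]
    simp only [← SchwartzMap.toLpCLM_apply (𝕜 := ℂ), map_sum, EuclideanSpace.basisFun_apply]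
  rw [e, sum_inner, ← Finset.sum_neg_distrib]
  refine Finset.sum_congr rfl fun i _ => ?_
  rw [inner_partialDeriv_left, partialDeriv_schwartzToH1]
  rfl

/-- The term V u conj f is integrable by the form bound, as u and f are both in H¹; no square
integrability of V f is needed. The Laplacian term is a product of L² functions, and integration by
parts identifies it. -/
theorem IsKatoClass.integrable_mul_schrodinger_and_q_eq (hV : IsKatoClass V) (u : H1)
    (f : 𝓢(R3, ℂ)) :
    Integrable (fun x => (u : L2) x * conj (schrodinger V f x)) ∧
      q V u (schwartzToH1 f) = ∫ x, (u : L2) x * conj (schrodinger V f x) := by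
  have hpot := hV.integrable_potential u (schwartzToH1 f)
  have hlap : Integrable fun x => (u : L2) x * conj (((Δ f).toLp 2 volume : L2) x) := by
    simpa only [RCLike.inner_apply] using
      L2.integrable_inner (𝕜 := ℂ) ((Δ f).toLp 2 volume : L2) (u : L2)
  have hae : (fun x => -((u : L2) x * conj (((Δ f).toLp 2 volume : L2) x)) +
      (V x : ℂ) * ((u : L2) x * conj ((schwartzToH1 f : L2) x))) =ᵐ[volume]
      fun x => (u : L2) x * conj (schrodinger V f x) := by
    filter_upwards [f.coeFn_toLp 2 volume, (Δ f).coeFn_toLp 2 volume] with x h1 h2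
    rw [h2, schwartzToH1, h1, schrodinger, map_add, map_neg, map_mul, Complex.conj_ofReal]
    ring
  refine ⟨(hlap.fun_neg.add hpot).congr hae, ?_⟩
  rw [← integral_congr_ae hae, integral_add hlap.fun_neg hpot, integral_neg, ← inner_eq_integral,
    inner_toLp_laplacian, neg_neg, q_eq_inner]

end Form

end KatoForm

theorem lemma2p1 (V : KatoForm.R3 → ℝ) (hV : KatoForm.IsKatoClass V) :
    (∀ u v : KatoForm.H1,
      Integrable (fun x => (V x : ℂ) * ((u : KatoForm.L2) x * conj ((v : KatoForm.L2) x)))) ∧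
    (∀ (u : KatoForm.H1) (f : 𝓢(KatoForm.R3, ℂ)),
      Integrable (fun x => (u : KatoForm.L2) x * conj (KatoForm.schrodinger V f x)) ∧
      KatoForm.q V u (KatoForm.schwartzToH1 f) =
        ∫ x, (u : KatoForm.L2) x * conj (KatoForm.schrodinger V f x)) ∧
    (∃ a₀ : ℝ, 1 < a₀ ∧ ∀ a : ℝ, a₀ ≤ a → ∀ u : KatoForm.H1,
      (KatoForm.q V u u).im = 0 ∧
      (1 / 2) * KatoForm.gradNormSq u - a * ‖(u : KatoForm.L2)‖ ^ 2 ≤ (KatoForm.q V u u).re ∧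
      (KatoForm.q V u u).re ≤
        (3 / 2) * KatoForm.gradNormSq u + a * ‖(u : KatoForm.L2)‖ ^ 2) ∧
    KatoForm.IsLowerSemiboundedForm KatoForm.H1 (KatoForm.q V) ∧
    KatoForm.IsClosedForm KatoForm.H1 (KatoForm.q V) :=
  ⟨hV.integrable_potential, hV.integrable_mul_schrodinger_and_q_eq, hV.exists_q_bounds,
    hV.isLowerSemiboundedForm, hV.isClosedForm⟩
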